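/- Let $f,g:[0,1]\to\mathbb R^2$ be piecewise linear maps (there are finitely many points $0=t_1<\dots<t_n=1$ such that the map is affine on each $[t_i,t_{i+1}]$) with $f([0,1])\cap g([0,1])=\emptyset$ and $\|f(t)-g(t)\|<\varepsilon$ for all $t\in[0,1]$. For $t\in[0,1]$ let $B_t=\overline{f(t)g(t)}$ be the straight segment joining $f(t)$ and $g(t)$, and suppose that $B_0\cap B_1=\emptyset$. Let $T_1=B_0\cup f([0,1])\cup g([0,1])\cup B_1$, regarded as a polygonal closed curve which runs along $f$ from $f(0)$ to $f(1)$, along $B_1$ to $g(1)$, backwards along $g$ to $g(0)$, and along $B_0$ to $f(0)$; its vertices are the images of the points $t_i$ for $f$ and for $g$. A point $z\in\mathbb R^2\setminus T_1$ is called odd if there is a polygonal arc $A$ (a finite chain of straight segments) from $z$ to a point of the unbounded component of $\mathbb R^2\setminus T_1$ such that $A$ contains no vertex of $T_1$, $T_1$ contains no vertex of $A$, and the number of intersections of $A$ with $T_1$ is odd, where an intersection point is counted once for every pair consisting of an edge of the closed curve $T_1$ and an edge of $A$ that both pass through it. A component of $\mathbb R^2\setminus T_1$ is odd if all its points are odd.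 The $\varepsilon$-strip with disjoint ends $S_1^-$ is the union of all odd components of $\mathbb R^2\setminus T_1$. Let $G\subset S_1^-$ be a graph, i.e. the union of a finite set of vertices and finitely many arcs that have their end points among the vertices, contain no other vertices, and meet each other only at end points. Let $$C=\{(x,t)\in G\times[0,1] : x\in B_t\}.$$ Then $C$ separates $G\times\{0\}$ from $G\times\{1\}$ in $G\times[0,1]$; that is, $(G\times[0,1])\setminus C$ is the union of two disjoint sets, both open in it, one of which contains $G\times\{0\}$ and the other $G\times\{1\}$. -/

import Mathlib

namespace PlaneStrip

/-- The plane with the Euclidean metric. -/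
abbrev Plane : Type := EuclideanSpace ℝ (Fin 2)

/-! ### Polygonal arcs and closed curves, given by the list of their vertices -/

/-- The edges of the polygonal arc with vertices `v₁, …, vₙ`: the pairs `(vᵢ, vᵢ₊₁)`. -/
def edges (v : List Plane) : List (Plane × Plane) := v.zip v.tail

/-- The polygonal arc with vertices `v₁, …, vₙ` as a subset of the plane: the union of the
segments joining consecutive vertices (and the point `v₁` alone if `n = 1`). -/
def trace (v : List Plane) : Set Plane :=
  {x | x ∈ v} ∪ ⋃ e ∈ edges v, segment ℝ e.1 e.2

/-- The number of intersection points of the polygonal arcs `T` and `A`, each point being counted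
once for every pair (edge of `T`, edge of `A`) through it. -/
noncomputable def crossings (T A : List Plane) : ℕ :=
  ((edges T ×ˢ edges A).map fun p =>
    (segment ℝ p.1.1 p.1.2 ∩ segment ℝ p.2.1 p.2.2).ncard).sum

/-- `A` is a polygonal arc from `z` to a point of the unbounded complementary domain of `T`, such
that neither of `A`, `T` passes through a vertex of the other. -/
def IsTestArc (T : List Plane) (z : Plane) (A : List Plane) : Prop :=
  A.head? = some z ∧
  (∃ w, A.getLast? = some w ∧ w ∉ trace T ∧
    ¬ Bornology.IsBounded (connectedComponentIn (trace T)ᶜ w)) ∧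
  (∀ x ∈ T, x ∉ trace A) ∧ (∀ x ∈ A, x ∉ trace T)

/-- The point `z` off the polygonal closed curve `T` is odd with respect to `T`. -/
def IsOddPoint (T : List Plane) (z : Plane) : Prop :=
  z ∉ trace T ∧ ∃ A, IsTestArc T z A ∧ Odd (crossings T A)

/-- The union of all odd complementary domains of the polygonal closed curve `T`: the components
of the complement of `T` all of whose points are odd. -/
def oddDomains (T : List Plane) : Set Plane :=
  ⋃₀ {U | ∃ z ∈ (trace T)ᶜ, U = connectedComponentIn (trace T)ᶜ z ∧ ∀ w ∈ U, IsOddPoint T w}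

/-! ### Piecewise linear maps and strips -/

/-- `l` is a list of points `a = t₁ < t₂ < … < tₙ = b` such that `f` is affine on each
interval `[tᵢ, tᵢ₊₁]`. -/
def IsBreakpoints (f : unitInterval → Plane) (a b : unitInterval) (l : List unitInterval) : Prop :=
  l.head? = some a ∧ l.getLast? = some b ∧
  l.IsChain fun s t => s < t ∧ ∀ u ∈ Set.Icc s t,
    f u = AffineMap.lineMap (f s) (f t) (((u : ℝ) - s) / (t - s))

/-- `f : [0,1] → ℝ²` is piecewise linear. -/
def IsPiecewiseLinear (f : unitInterval → Plane) : Prop :=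
  ∃ l, IsBreakpoints f 0 1 l

/-- The bridge `B_t`: the segment joining `f(t)` and `g(t)`. -/
def bridge (f g : unitInterval → Plane) (t : unitInterval) : Set Plane :=
  segment ℝ (f t) (g t)

/-- The vertices of the polygonal closed curve that runs along `f` from `f(0)` to `f(t)`, along
`B_t` to `g(t)`, back along `g` to `g(0)`, and along `B_0` to `f(0)`, where `k`, `l` list
breakpoints of `f` and `g` on `[0,t]`. -/
def stripCurve (f g : unitInterval → Plane) (k l : List unitInterval) : List Plane :=
  k.map f ++ (l.map g).reverse ++ [f 0]

/-- `S⁻_t`: the union of the odd complementary domains of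
`T_t = B_0 ∪ f([0,t]) ∪ g([0,t]) ∪ B_t`. Subdividing edges of a closed curve changes neither its
trace nor the parity of a point, so that the choice of the breakpoints does not matter. -/
def oddRegion (f g : unitInterval → Plane) (t : unitInterval) : Set Plane :=
  {z | ∃ k l, IsBreakpoints f 0 t k ∧ IsBreakpoints g 0 t l ∧ z ∈ oddDomains (stripCurve f g k l)}

/-- `f` and `g` define an `ε`-strip with disjoint ends; the strip itself is `oddRegion f g 1`. -/
structure IsStripWithDisjointEnds (ε : ℝ) (f g : unitInterval → Plane) : Prop where
  piecewiseLinear_left : IsPiecewiseLinear f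
  piecewiseLinear_right : IsPiecewiseLinear g
  disjoint_range : Disjoint (Set.range f) (Set.range g)
  dist_lt : ∀ t, dist (f t) (g t) < ε
  disjoint_ends : Disjoint (bridge f g 0) (bridge f g 1)

/-! ### Graphs and separators -/

/-- `G` is a (finite topological) graph in the plane: the union of a finite set `V` of vertices
and finitely many arcs with end points in `V`, whose interiors contain no vertices and are
pairwise disjoint. -/
def IsGraph (G : Set Plane) : Prop :=
  ∃ (V : Finset Plane) (n : ℕ) (γ : Fin n → unitInterval → Plane),
    (∀ i, Continuous (γ i) ∧ Function.Injective (γ i)) ∧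
    (∀ i, γ i 0 ∈ V ∧ γ i 1 ∈ V) ∧
    (∀ i, ∀ t ∈ Set.Ioo (0 : unitInterval) 1, γ i t ∉ V) ∧
    (∀ i j, i ≠ j → Disjoint (γ i '' Set.Ioo 0 1) (γ j '' Set.Ioo 0 1)) ∧
    G = (V : Set Plane) ∪ ⋃ i, Set.range (γ i)

/-- `C` separates `A` from `B` in the space `X`: the subspace `X \ C` is the union of two disjoint
sets, both open in `X \ C`, of which one contains `A` and the other contains `B`. -/
def Separates {X : Type*} [TopologicalSpace X] (C A B : Set X) : Prop :=
  ∃ U V : Set X, U ∪ V = Cᶜ ∧ Disjoint U V ∧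
    IsOpen ((↑) ⁻¹' U : Set (Cᶜ : Set X)) ∧ IsOpen ((↑) ⁻¹' V : Set (Cᶜ : Set X)) ∧
    A ⊆ U ∧ B ⊆ V

end PlaneStrip

namespace PlaneStrip

open Filter Topology

/-! ### Angles -/

/-! Fix `x` in `G` and let `W(x, t)` be the total angle by which `x` sees the closed curve `T_t`
turn, where `T_t` is formed by `B_0`, the initial pieces of `f` and `g` on `[0, t]`, and `B_t`. As
the curve is closed, `W` is a multiple of `2π`, and it varies continuously with `(x, t)` as long as
`x` is not on `B_t`, that is, off `C`. At `t = 0` the curve runs along `B_0` and back, so `W = 0`.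
At `t = 1`, `W` is the winding of `T_1` around an odd point, which is an odd multiple of `2π`. Hence
the parity of `W / 2π`, read off from the sign of `cos (W / 2)`, splits the complement of `C` as
required.

The geometric input is that an odd number of crossings forces odd winding
(`exists_int_winding_of_isOddPoint`). Each pair of an edge of `T` and an edge of the test arc
contributes a `turn`: zero if they are disjoint, `±2π` if they cross (`exists_int_turn_eq`). Summed
over all pairs, half of the terms telescope away because `T` is closed; the rest is the difference
of the windings at the two ends of the arc (`sum_turn_eq`). The winding vanishes in the unbounded
component (`winding_eq_zero_of_unbounded`). -/

/-- The oriented angle in `(-π, π]` under which `q` is seen from `x`, measured from `p`. -/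
noncomputable def ang (x p q : Plane) : ℝ :=
  Complex.arg ((Complex.orthonormalBasisOneI.repr.symm (q - x)) /
    (Complex.orthonormalBasisOneI.repr.symm (p - x)))

/-- The direction of `q` as seen from `x`. -/
noncomputable def dir (x q : Plane) : Real.Angle :=
  (Complex.arg (Complex.orthonormalBasisOneI.repr.symm (q - x)) : Real.Angle)

lemma repr_symm_ne_zero {x p : Plane} (h : x ≠ p) :
    Complex.orthonormalBasisOneI.repr.symm (p - x) ≠ 0 := by
  rw [map_ne_zero_iff _ (LinearIsometryEquiv.injective _)]
  exact sub_ne_zero.2 h.symm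

/-- This makes `ang` continuous wherever the observer is off the segment: a nonpositive real
quotient would put `x` between `p` and `q`. -/
lemma div_mem_slitPlane {x p q : Plane} (h : x ∉ segment ℝ p q) :
    (Complex.orthonormalBasisOneI.repr.symm (q - x)) /
    (Complex.orthonormalBasisOneI.repr.symm (p - x)) ∈ Complex.slitPlane := by
  have hp : x ≠ p := fun e => h (e ▸ left_mem_segment ℝ x q)
  have hP := repr_symm_ne_zero hp
  set c := Complex.orthonormalBasisOneI.repr.symm with hc
  by_contra hz
  rw [Complex.mem_slitPlane_iff] at hz
  push Not at hz
  obtain ⟨hre, him⟩ := hz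
  set z := c (q - x) / c (p - x) with hzdef
  have hzr : z = ((z.re : ℝ) : ℂ) := by
    apply Complex.ext <;> simp [him]
  have h1 : c (q - x) = c (z.re • (p - x)) := by
    rw [map_smul, Complex.real_smul, ← hzr, hzdef, div_mul_cancel₀ _ hP]
  have h2 := c.injective h1
  have h3 : 0 < 1 - z.re := by linarith
  apply h
  -- With `r = z.re ≤ 0`, solve `q - x = r • (p - x)` for `x`.
  refine ⟨(-z.re) / (1 - z.re), 1 / (1 - z.re), div_nonneg (by linarith) h3.le, by positivity, ?_, ?_⟩
  · field_simp; ring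
  · have : q = x + z.re • (p - x) := by rw [← h2]; abel
    rw [this]
    ext i
    simp
    field_simp
    ring

lemma coe_ang {x p q : Plane} (hp : x ≠ p) (hq : x ≠ q) :
    (ang x p q : Real.Angle) = dir x q - dir x p :=
  Complex.arg_div_coe_angle (repr_symm_ne_zero hq) (repr_symm_ne_zero hp)

lemma ang_self (x p : Plane) : ang x p p = 0 := by
  unfold ang
  by_cases h : Complex.orthonormalBasisOneI.repr.symm (p - x) = 0
  · simp [h]
  · rw [div_self h, Complex.arg_one]

lemma ang_swap {x p q : Plane} (h : x ∉ segment ℝ p q) : ang x q p = -ang x p q := by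
  unfold ang
  rw [← inv_div, Complex.arg_inv, if_neg (Complex.slitPlane_arg_ne_pi (div_mem_slitPlane h))]

lemma ContinuousAt.ang {α : Type*} [TopologicalSpace α] {X P Q : α → Plane} {a : α}
    (hX : ContinuousAt X a) (hP : ContinuousAt P a) (hQ : ContinuousAt Q a)
    (h : X a ∉ segment ℝ (P a) (Q a)) :
    ContinuousAt (fun t => ang (X t) (P t) (Q t)) a := by
  have hp : X a ≠ P a := fun e => h (e ▸ left_mem_segment ℝ _ _)
  refine ContinuousAt.comp (f := fun t => _ / _) (Complex.continuousAt_arg (div_mem_slitPlane h)) ?_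
  refine ContinuousAt.div ?_ ?_ (repr_symm_ne_zero hp)
  · exact (LinearIsometryEquiv.continuous _).continuousAt.comp (hQ.sub hX)
  · exact (LinearIsometryEquiv.continuous _).continuousAt.comp (hP.sub hX)

lemma exists_int_of_coe_eq_zero {r : ℝ} (h : (r : Real.Angle) = 0) :
    ∃ n : ℤ, r = n * (2 * Real.pi) := by
  obtain ⟨n, hn⟩ := Real.Angle.coe_eq_zero_iff.1 h
  exact ⟨n, by rw [← hn]; simp⟩

/-- A continuous function with values in the discrete set `2πℤ` is constant on a connected set. -/
lemma eq_of_coe_eq_zero {α : Type*} [TopologicalSpace α] {S : Set α} (hS : IsPreconnected S)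
    {F : α → ℝ} (hF : ContinuousOn F S) (h0 : ∀ x ∈ S, (F x : Real.Angle) = 0)
    {x y : α} (hx : x ∈ S) (hy : y ∈ S) : F x = F y := by
  have hd : IsDiscrete (Set.range ((↑) : ℤ → ℝ)) := by
    constructor
    exact (Int.isClosedEmbedding_coe_real.isEmbedding.toHomeomorph).symm.isEmbedding.discreteTopology
  have hpi : (2 * Real.pi) ≠ 0 := by positivity
  have := hS.constant_of_mapsTo hd (f := fun x => F x / (2 * Real.pi)) (hF.div_const _)
    (fun x hx => by
      obtain ⟨n, hn⟩ := exists_int_of_coe_eq_zero (h0 x hx)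
      exact ⟨n, by simp only [hn, mul_div_cancel_right₀ _ hpi]⟩) hx hy
  field_simp at this
  exact this

/-! ### Angular change along crossing segments -/

/-- Up to a multiple of `2π`, the difference of the two angular changes of a moving pair. -/
noncomputable def turn (e d : Plane × Plane) : ℝ :=
  ang d.2 e.1 e.2 - ang d.1 e.1 e.2 - (ang e.2 d.1 d.2 - ang e.1 d.1 d.2)

lemma dir_sub_dir {x p : Plane} (h : x ≠ p) : dir x p - dir p x = (Real.pi : Real.Angle) := by
  unfold dir
  have := repr_symm_ne_zero h
  rw [← neg_sub p x, map_neg, Complex.arg_neg_coe_angle this]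
  rw [sub_add_cancel_left, Real.Angle.neg_coe_pi]

/-- Swapping observer and target changes a direction by `π`; modulo `2π`, `turn` is an alternating
sum of four such changes, which cancel. -/
lemma coe_turn {p q a b : Plane} (h1 : a ≠ p) (h2 : a ≠ q) (h3 : b ≠ p) (h4 : b ≠ q) :
    (turn (p, q) (a, b) : Real.Angle) = 0 := by
  simp only [turn, Real.Angle.coe_sub, coe_ang h1 h2, coe_ang h3 h4, coe_ang h1.symm h3.symm,
    coe_ang h2.symm h4.symm]
  rw [show dir b q - dir b p - (dir a q - dir a p) - (dir q b - dir q a - (dir p b - dir p a))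
    = (dir b q - dir q b) - (dir b p - dir p b) - (dir a q - dir q a) + (dir a p - dir p a) by abel]
  rw [dir_sub_dir h1, dir_sub_dir h2, dir_sub_dir h3, dir_sub_dir h4]
  abel

/-- Shrink the first segment to the point `p`. It stays disjoint from the second, so `turn` stays
constant, and it is zero for a degenerate segment. -/
lemma turn_eq_zero {p q a b : Plane} (h : Disjoint (segment ℝ p q) (segment ℝ a b)) :
    turn (p, q) (a, b) = 0 := by
  have hsub : ∀ s ∈ Set.Icc (0 : ℝ) 1, segment ℝ p (AffineMap.lineMap p q s) ⊆ segment ℝ p q :=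
    fun s hs => (convex_segment p q).segment_subset (left_mem_segment ℝ p q)
      (by rw [segment_eq_image_lineMap]; exact ⟨s, hs, rfl⟩)
  have hd : ∀ s ∈ Set.Icc (0 : ℝ) 1,
      Disjoint (segment ℝ p (AffineMap.lineMap p q s)) (segment ℝ a b) :=
    fun s hs => h.mono_left (hsub s hs)
  have ha := left_mem_segment ℝ a b
  have hb := right_mem_segment ℝ a b
  have hcont : ContinuousOn (fun s : ℝ => turn (p, AffineMap.lineMap p q s) (a, b))
      (Set.Icc 0 1) := by
    intro s hs
    have hl : ContinuousAt (fun s : ℝ => AffineMap.lineMap (k := ℝ) p q s) s :=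
      AffineMap.lineMap_continuous.continuousAt
    refine ContinuousAt.continuousWithinAt ?_
    refine ((ContinuousAt.ang continuousAt_const continuousAt_const hl ?_).sub
      (ContinuousAt.ang continuousAt_const continuousAt_const hl ?_)).sub
      ((ContinuousAt.ang hl continuousAt_const continuousAt_const ?_).sub continuousAt_const)
    · exact (hd s hs).notMem_of_mem_right hb
    · exact (hd s hs).notMem_of_mem_right ha
    · exact (hd s hs).notMem_of_mem_left (right_mem_segment ℝ _ _)
  have key := eq_of_coe_eq_zero isPreconnected_Icc hcont (fun s hs => by
    have hp := left_mem_segment ℝ p (AffineMap.lineMap p q s)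
    have hq := right_mem_segment ℝ p (AffineMap.lineMap p q s)
    exact coe_turn ((hd s hs).ne_of_mem hp ha).symm ((hd s hs).ne_of_mem hq ha).symm
      ((hd s hs).ne_of_mem hp hb).symm ((hd s hs).ne_of_mem hq hb).symm)
    (x := 1) (y := 0) (by simp) (by simp)
  simpa [turn, ang_self] using key

/-- The oriented area spanned by two vectors. -/
def cross (u v : Plane) : ℝ := u 0 * v 1 - u 1 * v 0

lemma im_div_repr_symm (u v : Plane) :
    (Complex.orthonormalBasisOneI.repr.symm v / Complex.orthonormalBasisOneI.repr.symm u).im =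
      cross u v / Complex.normSq (Complex.orthonormalBasisOneI.repr.symm u) := by
  rw [Complex.div_im, cross, ← sub_div]
  congr 1
  simp [Complex.orthonormalBasisOneI_repr_symm_apply]
  ring

lemma ang_pos_of_cross_pos {x p q : Plane} (h : 0 < cross (p - x) (q - x)) :
    0 < ang x p q ∧ ang x p q < Real.pi := by
  have hp : x ≠ p := by rintro rfl; simp [cross] at h
  have him := im_div_repr_symm (p - x) (q - x)
  have hpos := div_pos h (Complex.normSq_pos.2 (repr_symm_ne_zero hp))
  rw [← him] at hpos
  have hz : (Complex.orthonormalBasisOneI.repr.symm (q - x)) /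
    (Complex.orthonormalBasisOneI.repr.symm (p - x)) ∈ Complex.slitPlane := Or.inr hpos.ne'
  refine ⟨lt_of_le_of_ne (Complex.arg_nonneg_iff.2 hpos.le) fun h0 => ?_,
    lt_of_le_of_ne (Complex.arg_le_pi _) (Complex.slitPlane_arg_ne_pi hz)⟩
  exact hpos.ne' (Complex.arg_eq_zero_iff.1 h0.symm).2

lemma ang_neg_of_cross_neg {x p q : Plane} (h : cross (p - x) (q - x) < 0) :
    -Real.pi < ang x p q ∧ ang x p q < 0 := by
  have hp : x ≠ p := by rintro rfl; simp [cross] at h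
  have him := im_div_repr_symm (p - x) (q - x)
  have hneg := div_neg_of_neg_of_pos h (Complex.normSq_pos.2 (repr_symm_ne_zero hp))
  rw [← him] at hneg
  exact ⟨Complex.neg_pi_lt_arg _, Complex.arg_neg_iff.2 hneg⟩

lemma mem_segment_iff_lineMap {x p q : Plane} :
    x ∈ segment ℝ p q ↔ ∃ s : ℝ, 0 ≤ s ∧ s ≤ 1 ∧ ∀ i, x i = p i + s * (q i - p i) := by
  rw [segment_eq_image_lineMap]
  constructor
  · rintro ⟨s, hs, rfl⟩
    exact ⟨s, hs.1, hs.2, fun i => by simp [AffineMap.lineMap_apply]; ring⟩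
  · rintro ⟨s, h0, h1, h⟩
    exact ⟨s, ⟨h0, h1⟩, by ext i; rw [h i]; simp [AffineMap.lineMap_apply]; ring⟩

/-- If the segments were parallel, they would overlap on a line. Going from the common point `x`
towards `p`, one would meet either `p` or an end of the other segment first, and that point would
lie on both segments. -/
lemma cross_ne_zero_of_mem {p q a b x : Plane} (hx : x ∈ segment ℝ p q)
    (hx' : x ∈ segment ℝ a b) (hp : p ∉ segment ℝ a b)
    (ha : a ∉ segment ℝ p q) (hb : b ∉ segment ℝ p q) : cross (q - p) (b - a) ≠ 0 := by
  intro hD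
  have hne : p ≠ q := by
    rintro rfl
    rw [segment_same, Set.mem_singleton_iff] at hx
    exact hp (hx ▸ hx')
  obtain ⟨s, hs0, hs1, hs⟩ := mem_segment_iff_lineMap.1 hx
  obtain ⟨u, hu0, hu1, hu⟩ := mem_segment_iff_lineMap.1 hx'
  obtain ⟨l, hl⟩ : ∃ l : ℝ, ∀ i, b i - a i = l * (q i - p i) := by
    simp only [cross, PiLp.sub_apply] at hD
    by_cases h0 : q 0 - p 0 = 0
    · have h1 : q 1 - p 1 ≠ 0 := fun h1 => hne (by
        ext i; fin_cases i
        · exact (sub_eq_zero.1 h0).symm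
        · exact (sub_eq_zero.1 h1).symm)
      refine ⟨(b 1 - a 1) / (q 1 - p 1), fun i => ?_⟩
      fin_cases i
      · simp only [h0, zero_mul, zero_sub, neg_eq_zero, mul_eq_zero, h1, false_or] at hD
        simp [h0, hD]
      · simp [div_mul_cancel₀ _ h1]
    · refine ⟨(b 0 - a 0) / (q 0 - p 0), fun i => ?_⟩
      fin_cases i
      · simp [div_mul_cancel₀ _ h0]
      · simp; field_simp; linarith
  -- The sign of `l` decides whether `a` or `b` lies on the same side of `x` as `p`.
  rcases le_total 0 l with hl0 | hl0
  · by_cases hc : u * l ≤ s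
    · refine ha (mem_segment_iff_lineMap.2 ⟨s - u * l, by linarith, by nlinarith, fun i => ?_⟩)
      linear_combination hs i - hu i - u * hl i
    · push Not at hc
      have hlp : 0 < l := by
        rcases hl0.lt_or_eq with h | h
        · exact h
        · subst h; linarith
      have h1 : s / l ≤ u := by rw [div_le_iff₀ hlp]; exact hc.le
      have h2 : 0 ≤ s / l := by positivity
      refine hp (mem_segment_iff_lineMap.2 ⟨u - s / l, by linarith, by linarith, fun i => ?_⟩)
      have : s / l * (b i - a i) = s * (q i - p i) := by rw [hl i]; field_simp
      linear_combination hu i - hs i + this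
  · by_cases hc : (1 - u) * (-l) ≤ s
    · refine hb (mem_segment_iff_lineMap.2 ⟨s + (1 - u) * l, by linarith, by nlinarith,
        fun i => ?_⟩)
      linear_combination hs i - hu i + (1 - u) * hl i
    · push Not at hc
      have hlp : l < 0 := by
        rcases hl0.lt_or_eq with h | h
        · exact h
        · subst h; linarith
      have h1 : s / (-l) ≤ 1 - u := by rw [div_le_iff₀ (by linarith)]; exact hc.le
      have h2 : 0 ≤ s / (-l) := div_nonneg hs0 (by linarith)
      refine hp (mem_segment_iff_lineMap.2 ⟨u + s / (-l), by linarith, by linarith, fun i => ?_⟩)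
      have : s / (-l) * (b i - a i) = - (s * (q i - p i)) := by
        have := hlp.ne
        rw [hl i]; field_simp
      linear_combination hu i - hs i - this

/-- At a transversal crossing the four angles enter `turn` with the same sign, and each is less than
`π` in absolute value. So `turn` is a nonzero multiple of `2π` strictly between `-4π` and `4π`,
hence `±2π`. -/
lemma exists_int_turn_eq {p q a b : Plane} (hp : p ∉ segment ℝ a b) (hq : q ∉ segment ℝ a b)
    (ha : a ∉ segment ℝ p q) (hb : b ∉ segment ℝ p q) :
    ∃ n : ℤ, turn (p, q) (a, b) = n * (2 * Real.pi) ∧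
      (Odd n ↔ Odd (segment ℝ p q ∩ segment ℝ a b).ncard) := by
  by_cases hdis : Disjoint (segment ℝ p q) (segment ℝ a b)
  · refine ⟨0, by simp [turn_eq_zero hdis], ?_⟩
    simp [hdis.inter_eq]
  obtain ⟨x, hx, hx'⟩ := Set.not_disjoint_iff.1 hdis
  have hD := cross_ne_zero_of_mem hx hx' hp ha hb
  have hone : segment ℝ p q ∩ segment ℝ a b = {x} := by
    refine Set.eq_singleton_iff_unique_mem.2 ⟨⟨hx, hx'⟩, ?_⟩
    rintro y ⟨hy, hy'⟩
    obtain ⟨s, -, -, hs⟩ := mem_segment_iff_lineMap.1 hx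
    obtain ⟨u, -, -, hu⟩ := mem_segment_iff_lineMap.1 hx'
    obtain ⟨s', -, -, hs'⟩ := mem_segment_iff_lineMap.1 hy
    obtain ⟨u', -, -, hu'⟩ := mem_segment_iff_lineMap.1 hy'
    have hz : (s' - s) * cross (q - p) (b - a) = 0 := by
      simp only [cross, PiLp.sub_apply]
      linear_combination (b 1 - a 1) * (-(hs' 0) + hs 0 + hu' 0 - hu 0) -
        (b 0 - a 0) * (-(hs' 1) + hs 1 + hu' 1 - hu 1)
    have : s' = s := by
      rcases mul_eq_zero.1 hz with h | h
      · linarith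
      · exact absurd h hD
    ext i
    rw [hs' i, hs i, this]
  obtain ⟨s, hs0, hs1, hs⟩ := mem_segment_iff_lineMap.1 hx
  obtain ⟨u, hu0, hu1, hu⟩ := mem_segment_iff_lineMap.1 hx'
  have ne_of : ∀ r : ℝ, ∀ y z w : Plane, (∀ i, x i = y i + r * (z i - y i)) →
      (w = y ∧ r = 0 ∨ w = z ∧ r = 1) → x = w := by
    rintro r y z w h (⟨rfl, rfl⟩ | ⟨rfl, rfl⟩) <;> ext i <;> rw [h i] <;> ring
  have hs0' : 0 < s := lt_of_le_of_ne hs0 fun h => hp ((ne_of s p q p hs (by simp [← h])) ▸ hx')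
  have hs1' : s < 1 := lt_of_le_of_ne hs1 fun h => hq ((ne_of s p q q hs (by simp [h])) ▸ hx')
  have hu0' : 0 < u := lt_of_le_of_ne hu0 fun h => ha ((ne_of u a b a hu (by simp [← h])) ▸ hx)
  have hu1' : u < 1 := lt_of_le_of_ne hu1 fun h => hb ((ne_of u a b b hu (by simp [h])) ▸ hx)
  have e0 := (hs 0).symm.trans (hu 0)
  have e1 := (hs 1).symm.trans (hu 1)
  -- The two ends of each segment lie on opposite sides of the other, so the signs of the four
  -- angles are fixed by that of `cross (q - p) (b - a)`.
  have c1 : cross (p - b) (q - b) = (1 - u) * cross (q - p) (b - a) := by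
    simp only [cross, PiLp.sub_apply]
    linear_combination (q 1 - p 1) * e0 - (q 0 - p 0) * e1
  have c2 : cross (p - a) (q - a) = -(u * cross (q - p) (b - a)) := by
    simp only [cross, PiLp.sub_apply]
    linear_combination (q 1 - p 1) * e0 - (q 0 - p 0) * e1
  have c3 : cross (a - q) (b - q) = -((1 - s) * cross (q - p) (b - a)) := by
    simp only [cross, PiLp.sub_apply]
    linear_combination -(b 1 - a 1) * e0 + (b 0 - a 0) * e1
  have c4 : cross (a - p) (b - p) = s * cross (q - p) (b - a) := by
    simp only [cross, PiLp.sub_apply]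
    linear_combination -(b 1 - a 1) * e0 + (b 0 - a 0) * e1
  have hpi := Real.pi_pos
  obtain ⟨n, hn⟩ := exists_int_of_coe_eq_zero (coe_turn (p := p) (q := q) (a := a) (b := b)
    (fun h => ha (h ▸ left_mem_segment ℝ _ _)) (fun h => ha (h ▸ right_mem_segment ℝ _ _))
    (fun h => hb (h ▸ left_mem_segment ℝ _ _)) (fun h => hb (h ▸ right_mem_segment ℝ _ _)))
  refine ⟨n, hn, ?_⟩
  rw [hone, Set.ncard_singleton]
  simp only [odd_one, iff_true]
  simp only [turn] at hn
  rcases lt_or_gt_of_ne hD with h | h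
  · have a1 := ang_neg_of_cross_neg (x := b) (p := p) (q := q) (by rw [c1]; nlinarith)
    have a2 := ang_pos_of_cross_pos (x := a) (p := p) (q := q) (by rw [c2]; nlinarith)
    have a3 := ang_pos_of_cross_pos (x := q) (p := a) (q := b) (by rw [c3]; nlinarith)
    have a4 := ang_neg_of_cross_neg (x := p) (p := a) (q := b) (by rw [c4]; nlinarith)
    have l1 : (n : ℝ) < 0 := by nlinarith
    have l2 : (-2 : ℝ) < n := by nlinarith
    have l1' : n < 0 := by exact_mod_cast l1
    have l2' : -2 < n := by exact_mod_cast l2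
    have : n = -1 := by omega
    subst this
    decide
  · have a1 := ang_pos_of_cross_pos (x := b) (p := p) (q := q) (by rw [c1]; nlinarith)
    have a2 := ang_neg_of_cross_neg (x := a) (p := p) (q := q) (by rw [c2]; nlinarith)
    have a3 := ang_neg_of_cross_neg (x := q) (p := a) (q := b) (by rw [c3]; nlinarith)
    have a4 := ang_pos_of_cross_pos (x := p) (p := a) (q := b) (by rw [c4]; nlinarith)
    have l1 : (0 : ℝ) < n := by nlinarith
    have l2 : (n : ℝ) < 2 := by nlinarith
    have l1' : 0 < n := by exact_mod_cast l1
    have l2' : n < 2 := by exact_mod_cast l2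
    have : n = 1 := by omega
    subst this
    decide

/-! ### Sums over the edges of a list -/

/-- The sum of `h` over the pairs of consecutive members of a list. -/
def edgeSum {α M : Type*} [AddMonoid M] (h : α → α → M) (v : List α) : M :=
  ((v.zip v.tail).map fun e => h e.1 e.2).sum

section edgeSum

variable {α β M : Type*}

@[simp] lemma edgeSum_singleton [AddMonoid M] (h : α → α → M) (a : α) : edgeSum h [a] = 0 := rfl

@[simp] lemma edgeSum_cons_cons [AddMonoid M] (h : α → α → M) (a b : α) (v : List α) :
    edgeSum h (a :: b :: v) = h a b + edgeSum h (b :: v) := by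
  simp [edgeSum]

lemma edgeSum_map [AddMonoid M] (h : β → β → M) (φ : α → β) (v : List α) :
    edgeSum h (v.map φ) = edgeSum (fun a b => h (φ a) (φ b)) v := by
  simp [edgeSum, ← List.map_tail, List.zip_map, List.map_map, Function.comp_def]

lemma zip_tail_append {v w : List α} {a b : α} (hv : v.getLast? = some a)
    (hw : w.head? = some b) :
    (v ++ w).zip (v ++ w).tail = v.zip v.tail ++ (a, b) :: w.zip w.tail := by
  induction v with
  | nil => simp at hv
  | cons c v ih =>
    cases v with
    | nil =>
      cases w with
      | nil => simp at hw
      | cons d w =>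
        simp at hv hw
        subst hv hw
        simp
    | cons d v =>
      rw [List.getLast?_cons_cons] at hv
      simpa using ih hv

lemma zip_tail_reverse (v : List α) :
    v.reverse.zip v.reverse.tail = ((v.zip v.tail).map Prod.swap).reverse := by
  induction v with
  | nil => simp
  | cons c v ih =>
    cases v with
    | nil => simp
    | cons d v =>
      rw [List.reverse_cons, zip_tail_append (a := d) (b := c) (by simp) rfl, ih]
      simp

lemma edgeSum_append [AddMonoid M] (h : α → α → M) {v w : List α} {a b : α}
    (hv : v.getLast? = some a) (hw : w.head? = some b) :
    edgeSum h (v ++ w) = edgeSum h v + (h a b + edgeSum h w) := by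
  simp [edgeSum, zip_tail_append hv hw]

lemma edgeSum_reverse [AddCommGroup M] (h : α → α → M) {v : List α}
    (hv : ∀ e ∈ v.zip v.tail, h e.2 e.1 = -h e.1 e.2) :
    edgeSum h v.reverse = -edgeSum h v := by
  rw [edgeSum, edgeSum, zip_tail_reverse, List.map_reverse, List.sum_reverse, List.map_map,
    List.sum_neg, List.map_map]
  exact congrArg List.sum (List.map_congr_left hv)

/-- Telescoping; on a closed list the sum is zero. -/
lemma edgeSum_sub [AddCommGroup M] (h : α → M) {v : List α} {a b : α}
    (ha : v.head? = some a) (hb : v.getLast? = some b) :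
    edgeSum (fun x y => h y - h x) v = h b - h a := by
  induction v generalizing a with
  | nil => simp at ha
  | cons c v ih =>
    cases v with
    | nil => simp at ha hb; subst ha hb; simp
    | cons d v =>
      rw [List.getLast?_cons_cons] at hb
      simp at ha
      subst ha
      rw [edgeSum_cons_cons, ih rfl hb]
      abel

lemma edgeSum_congr [AddMonoid M] {h h' : α → α → M} {v : List α}
    (H : ∀ e ∈ v.zip v.tail, h e.1 e.2 = h' e.1 e.2) : edgeSum h v = edgeSum h' v := by
  unfold edgeSum
  rw [List.map_congr_left H]

lemma edgeSum_coe (h : α → α → ℝ) (v : List α) :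
    ((edgeSum h v : ℝ) : Real.Angle) = edgeSum (fun a b => (h a b : Real.Angle)) v := by
  unfold edgeSum
  induction v.zip v.tail with
  | nil => simp
  | cons e l ih => simp [ih]

lemma continuousAt_edgeSum {X : Type*} [TopologicalSpace X] (h : X → α → α → ℝ) {v : List α} {x : X}
    (H : ∀ e ∈ v.zip v.tail, ContinuousAt (fun y => h y e.1 e.2) x) :
    ContinuousAt (fun y => edgeSum (h y) v) x := by
  unfold edgeSum
  generalize v.zip v.tail = l at H
  induction l with
  | nil => simpa using continuousAt_const
  | cons e l ih =>
    simp only [List.map_cons, List.sum_cons]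
    exact (H e List.mem_cons_self).add (ih fun e' he' => H e' (List.mem_cons_of_mem _ he'))

end edgeSum

lemma sum_map_product {α β : Type*} (l : List α) (m : List β) (h : α → β → ℝ) :
    ((l ×ˢ m).map fun p => h p.1 p.2).sum = (l.map fun a => (m.map fun b => h a b).sum).sum := by
  induction l with
  | nil => simp
  | cons a l ih =>
    rw [List.product_cons, List.map_append, List.sum_append, ih]
    simp [Function.comp_def]

lemma sum_map_sub {α : Type*} (l : List α) (h h' : α → ℝ) :
    (l.map fun a => h a - h' a).sum = (l.map h).sum - (l.map h').sum := by
  induction l with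
  | nil => simp
  | cons a l ih =>
    simp only [List.map_cons, List.sum_cons, ih]
    ring

lemma sum_map_product_swap {α β : Type*} (l : List α) (m : List β) (h : α → β → ℝ) :
    ((l ×ˢ m).map fun p => h p.1 p.2).sum = (m.map fun b => (l.map fun a => h a b).sum).sum := by
  rw [sum_map_product]
  induction l with
  | nil => simp
  | cons a l ih => simp [ih, List.sum_map_add]

/-! ### The winding of a polygonal curve around a point -/

/-- The total angle by which `x` sees the polygonal curve `T` turn. -/
noncomputable def winding (T : List Plane) (x : Plane) : ℝ := edgeSum (ang x) T

lemma segment_subset_trace {T : List Plane} {e : Plane × Plane} (he : e ∈ edges T) :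
    segment ℝ e.1 e.2 ⊆ trace T :=
  fun _ hx => Or.inr (Set.mem_biUnion he hx)

lemma mem_of_mem_edges {α : Type*} {v : List α} {e : α × α} (he : e ∈ v.zip v.tail) :
    e.1 ∈ v ∧ e.2 ∈ v :=
  ⟨(List.of_mem_zip he).1, List.mem_of_mem_tail (List.of_mem_zip he).2⟩

lemma coe_winding {T : List Plane} {a b x : Plane} (ha : T.head? = some a)
    (hb : T.getLast? = some b) (hx : ∀ p ∈ T, x ≠ p) :
    (winding T x : Real.Angle) = dir x b - dir x a := by
  rw [winding, edgeSum_coe, ← edgeSum_sub (dir x) ha hb]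
  refine edgeSum_congr fun e he => ?_
  obtain ⟨h1, h2⟩ := mem_of_mem_edges he
  exact coe_ang (hx _ h1) (hx _ h2)

lemma continuousAt_winding {T : List Plane} {x : Plane} (hx : x ∉ trace T) :
    ContinuousAt (winding T) x :=
  continuousAt_edgeSum _ fun _ he => ContinuousAt.ang continuousAt_id continuousAt_const
    continuousAt_const fun h => hx (segment_subset_trace he h)

/-- The quotient of which `ang` is the argument equals `1 + (q - p) / (p - x)`, which tends to `1`.
-/
lemma tendsto_ang_cobounded (p q : Plane) :
    Tendsto (fun x => ang x p q) (Bornology.cobounded Plane) (𝓝 0) := by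
  set c := Complex.orthonormalBasisOneI.repr.symm with hc
  have h1 : Tendsto (fun x : Plane => c (p - x)) (Bornology.cobounded Plane)
      (Bornology.cobounded ℂ) := by
    rw [← tendsto_norm_atTop_iff_cobounded]
    simp only [LinearIsometryEquiv.norm_map]
    have := tendsto_norm_cobounded_atTop (E := Plane)
    refine tendsto_atTop_mono (f := fun x => ‖x‖ - ‖p‖) (fun x => ?_)
      (tendsto_atTop_add_const_right _ _ this)
    rw [← norm_sub_rev]
    exact norm_sub_norm_le x p
  have h2 : Tendsto (fun x : Plane => 1 + c (q - p) * (c (p - x))⁻¹) (Bornology.cobounded Plane)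
      (𝓝 1) := by
    simpa using ((tendsto_inv₀_cobounded.comp h1).const_mul (c (q - p))).const_add 1
  have h3 : Tendsto (fun x : Plane => c (q - x) / c (p - x)) (Bornology.cobounded Plane)
      (𝓝 1) := by
    refine h2.congr' ?_
    have hne : ∀ᶠ x in Bornology.cobounded Plane, x ≠ p :=
      Bornology.isBounded_def.1 (Bornology.isBounded_singleton (x := p))
    filter_upwards [hne] with x hx
    have := repr_symm_ne_zero hx
    rw [← hc] at this
    field_simp
    rw [← map_add]
    congr 1
    abel
  have h4 := (Complex.continuousAt_arg (x := 1) (by simp)).tendsto.comp h3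
  rwa [Complex.arg_one] at h4

lemma tendsto_winding_cobounded (T : List Plane) :
    Tendsto (winding T) (Bornology.cobounded Plane) (𝓝 0) := by
  unfold winding edgeSum
  induction T.zip T.tail with
  | nil => simp
  | cons e l ih =>
    simp only [List.map_cons, List.sum_cons]
    simpa using (tendsto_ang_cobounded e.1 e.2).add ih

lemma ne_of_notMem_trace {T : List Plane} {x : Plane} (hx : x ∉ trace T) : ∀ p ∈ T, x ≠ p :=
  fun _ hp e => hx (Or.inl (e ▸ hp))

lemma coe_winding_closed {T : List Plane} {a x : Plane} (ha : T.head? = some a)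
    (hb : T.getLast? = some a) (hx : x ∉ trace T) : (winding T x : Real.Angle) = 0 := by
  rw [coe_winding ha hb (ne_of_notMem_trace hx), sub_self]

/-- The winding is constant on the component. It is a multiple of `2π`, and far out it is smaller
than `2π` in absolute value. -/
lemma winding_eq_zero_of_unbounded {T : List Plane} {a w : Plane} (ha : T.head? = some a)
    (hb : T.getLast? = some a) (hw : w ∉ trace T)
    (hub : ¬ Bornology.IsBounded (connectedComponentIn (trace T)ᶜ w)) : winding T w = 0 := by
  have hsub := connectedComponentIn_subset (trace T)ᶜ w
  have hev := (tendsto_winding_cobounded T).eventually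
    (Metric.ball_mem_nhds 0 (by positivity : (0 : ℝ) < 2 * Real.pi))
  obtain ⟨y, hy, hyK⟩ : ∃ y, winding T y ∈ Metric.ball 0 (2 * Real.pi) ∧
      y ∈ connectedComponentIn (trace T)ᶜ w := by
    by_contra! hcon
    refine hub (Bornology.IsBounded.subset ?_ (t := {y | winding T y ∈ Metric.ball 0 (2 * Real.pi)}ᶜ)
      fun y hy hy' => hcon y hy' hy)
    rw [← Bornology.isCobounded_compl_iff, compl_compl]
    exact hev
  rw [eq_of_coe_eq_zero isPreconnected_connectedComponentIn
    (fun x hx => (continuousAt_winding (hsub hx)).continuousWithinAt)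
    (fun x hx => coe_winding_closed ha hb (hsub hx)) (mem_connectedComponentIn hw) hyK]
  obtain ⟨n, hn⟩ := exists_int_of_coe_eq_zero (coe_winding_closed ha hb (hsub hyK))
  rw [mem_ball_zero_iff, hn, Real.norm_eq_abs, abs_mul,
    abs_of_pos (by positivity : 0 < 2 * Real.pi)] at hy
  have h1 : |(n : ℝ)| < 1 := by
    have : 0 < 2 * Real.pi := by positivity
    nlinarith
  have h2 : n = 0 := Int.abs_lt_one_iff.1 (by exact_mod_cast h1)
  simp [hn, h2]

lemma exists_int_sum_turn {T A : List Plane} (l : List ((Plane × Plane) × (Plane × Plane)))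
    (hl : ∀ p ∈ l, p.1 ∈ edges T ∧ p.2 ∈ edges A)
    (hTA : ∀ x ∈ T, x ∉ trace A) (hAT : ∀ x ∈ A, x ∉ trace T) :
    ∃ n : ℤ, (l.map fun p => turn p.1 p.2).sum = n * (2 * Real.pi) ∧ (Odd n ↔
      Odd (l.map fun p => (segment ℝ p.1.1 p.1.2 ∩ segment ℝ p.2.1 p.2.2).ncard).sum) := by
  induction l with
  | nil => exact ⟨0, by simp, by simp⟩
  | cons p l ih =>
    obtain ⟨n, hn, hodd⟩ := ih fun q hq => hl q (by simp [hq])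
    obtain ⟨h1, h2⟩ := hl p (by simp)
    obtain ⟨⟨p, q⟩, ⟨a, b⟩⟩ := p
    obtain ⟨m, hm, hmodd⟩ := exists_int_turn_eq (p := p) (q := q) (a := a) (b := b)
      (fun h => hTA _ (mem_of_mem_edges h1).1 (segment_subset_trace h2 h))
      (fun h => hTA _ (mem_of_mem_edges h1).2 (segment_subset_trace h2 h))
      (fun h => hAT _ (mem_of_mem_edges h2).1 (segment_subset_trace h1 h))
      (fun h => hAT _ (mem_of_mem_edges h2).2 (segment_subset_trace h1 h))
    refine ⟨m + n, ?_, ?_⟩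
    · simp only [List.map_cons, List.sum_cons, hn, hm]
      push_cast
      ring
    · simp only [List.map_cons, List.sum_cons]
      rw [Int.odd_add, Nat.odd_add, hmodd, ← Int.not_odd_iff_even, hodd, Nat.not_odd_iff_even]

lemma sum_turn_eq {T A : List Plane} {a z w : Plane} (ha : T.head? = some a)
    (hb : T.getLast? = some a) (hz : A.head? = some z) (hw : A.getLast? = some w) :
    ((edges T ×ˢ edges A).map fun p => turn p.1 p.2).sum = winding T w - winding T z := by
  have h1 : ∀ d ∈ edges A, ((edges T).map fun e => turn e d).sum
      = winding T d.2 - winding T d.1 := by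
    intro d _
    -- The angles under which the vertices of `T` see `d` telescope around the closed curve.
    have h0 : ((edges T).map fun e => ang e.2 d.1 d.2 - ang e.1 d.1 d.2).sum = 0 :=
      (edgeSum_sub (fun q => ang q d.1 d.2) ha hb).trans (sub_self _)
    have h2 := sum_map_sub (edges T) (fun e => ang d.2 e.1 e.2 - ang d.1 e.1 e.2)
      (fun e => ang e.2 d.1 d.2 - ang e.1 d.1 d.2)
    have h3 := sum_map_sub (edges T) (fun e => ang d.2 e.1 e.2) (fun e => ang d.1 e.1 e.2)
    rw [h0, sub_zero, h3] at h2
    exact h2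
  rw [sum_map_product_swap, List.map_congr_left h1]
  exact edgeSum_sub (winding T) hz hw

lemma exists_int_winding_of_isOddPoint {T : List Plane} {a z : Plane} (ha : T.head? = some a)
    (hb : T.getLast? = some a) (hz : IsOddPoint T z) :
    ∃ n : ℤ, Odd n ∧ winding T z = n * (2 * Real.pi) := by
  obtain ⟨-, A, ⟨hzA, ⟨w, hwA, hw, hub⟩, hTA, hAT⟩, hodd⟩ := hz
  obtain ⟨n, hn, hn'⟩ := exists_int_sum_turn (edges T ×ˢ edges A)
    (fun p hp => List.mem_product.1 hp) hTA hAT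
  rw [sum_turn_eq ha hb hzA hwA, winding_eq_zero_of_unbounded ha hb hw hub] at hn
  exact ⟨-n, (hn'.2 hodd).neg, by push_cast; linarith⟩

/-! ### Piecewise linear maps -/

section breakpoints

variable {f : unitInterval → Plane} {a b : unitInterval} {l : List unitInterval}

/-- The defining property of the breakpoints of `f` on an interval whose ends are consecutive
breakpoints. -/
def IsAffineBetween (f : unitInterval → Plane) (s t : unitInterval) : Prop :=
  s < t ∧ ∀ u ∈ Set.Icc s t, f u = AffineMap.lineMap (f s) (f t) (((u : ℝ) - s) / (t - s))

lemma isBreakpoints_cons_cons {c d : unitInterval} :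
    IsBreakpoints f a b (c :: d :: l) ↔
      c = a ∧ IsAffineBetween f c d ∧ IsBreakpoints f d b (d :: l) := by
  simp only [IsBreakpoints, List.isChain_cons_cons, List.getLast?_cons_cons, List.head?_cons,
    Option.some.injEq, true_and, IsAffineBetween]
  tauto

lemma IsAffineBetween.sub_pos {s t : unitInterval} (h : IsAffineBetween f s t) :
    0 < (t : ℝ) - s := _root_.sub_pos.2 h.1

lemma IsAffineBetween.continuousOn {s t : unitInterval} (h : IsAffineBetween f s t) :
    ContinuousOn f (Set.Icc s t) := by
  have hc : Continuous fun u : unitInterval =>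
      AffineMap.lineMap (k := ℝ) (f s) (f t) (((u : ℝ) - s) / (t - s)) :=
    AffineMap.lineMap_continuous.comp (by fun_prop)
  exact hc.continuousOn.congr h.2

lemma IsAffineBetween.image_subset {s t : unitInterval} (h : IsAffineBetween f s t) :
    f '' Set.Icc s t ⊆ segment ℝ (f s) (f t) := by
  rintro _ ⟨u, hu, rfl⟩
  rw [h.2 u hu, segment_eq_image_lineMap]
  have h1 : (s : ℝ) ≤ u := hu.1
  have h2 : (u : ℝ) ≤ t := hu.2
  exact ⟨_, ⟨div_nonneg (by linarith) h.sub_pos.le,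
    (div_le_one h.sub_pos).2 (by linarith)⟩, rfl⟩

lemma IsAffineBetween.segment_subset_range {s t u : unitInterval} (h : IsAffineBetween f s t)
    (hu : u ∈ Set.Icc s t) : segment ℝ (f s) (f u) ⊆ Set.range f := by
  rw [segment_eq_image_lineMap]
  rintro _ ⟨r, hr, rfl⟩
  have h1 : (s : ℝ) ≤ u := hu.1
  have h2 : (u : ℝ) ≤ t := hu.2
  have hs := s.2.1
  have hv1 : (s : ℝ) ≤ s + r * (u - s) := by nlinarith [hr.1]
  have hv2 : (s : ℝ) + r * (u - s) ≤ u := by nlinarith [hr.2]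
  let v : unitInterval := ⟨s + r * (u - s), by linarith, by linarith [u.2.2]⟩
  refine ⟨v, ?_⟩
  rw [h.2 v ⟨hv1, hv2.trans h2⟩, h.2 u hu]
  ext i
  have := h.sub_pos.ne'
  simp only [AffineMap.lineMap_apply, v, PiLp.add_apply, PiLp.smul_apply, vsub_eq_sub, vadd_eq_add,
    PiLp.sub_apply, smul_eq_mul]
  field_simp
  ring

lemma IsBreakpoints.isAffineBetween (h : IsBreakpoints f a b l) :
    ∀ e ∈ l.zip l.tail, IsAffineBetween f e.1 e.2 := by
  induction l generalizing a with
  | nil => simp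
  | cons c l ih =>
    cases l with
    | nil => simp
    | cons d l =>
      obtain ⟨-, h1, h2⟩ := isBreakpoints_cons_cons.1 h
      intro e he
      rw [List.tail_cons, List.zip_cons_cons, List.mem_cons] at he
      rcases he with rfl | he
      · exact h1
      · exact ih h2 e he

lemma IsBreakpoints.le_and_continuousOn_and_subset (h : IsBreakpoints f a b l) :
    a ≤ b ∧ ContinuousOn f (Set.Icc a b) ∧ f '' Set.Icc a b ⊆ trace (l.map f) := by
  induction l generalizing a with
  | nil => simp [IsBreakpoints] at h
  | cons c l ih =>
    cases l with
    | nil =>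
      obtain ⟨h1, h2, -⟩ := h
      simp at h1 h2
      subst h1 h2
      simp [trace]
    | cons d l =>
      obtain ⟨rfl, h1, h2⟩ := isBreakpoints_cons_cons.1 h
      obtain ⟨i1, i2, i3⟩ := ih h2
      rw [← Set.Icc_union_Icc_eq_Icc h1.1.le i1]
      refine ⟨h1.1.le.trans i1, h1.continuousOn.union_of_isClosed i2 isClosed_Icc isClosed_Icc, ?_⟩
      rw [Set.image_union]
      refine Set.union_subset (h1.image_subset.trans ?_) (i3.trans ?_)
      · exact segment_subset_trace (e := (f c, f d)) (by simp [edges])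
      · rintro x (hx | hx)
        · exact Or.inl (List.mem_cons_of_mem _ hx)
        · obtain ⟨e, he, hx⟩ := Set.mem_iUnion₂.1 hx
          exact segment_subset_trace (by simp [edges] at he ⊢; exact Or.inr he) hx

lemma Icc_zero_one_eq_univ : Set.Icc (0 : unitInterval) 1 = Set.univ :=
  Set.eq_univ_of_forall fun t => ⟨t.2.1, t.2.2⟩

lemma IsPiecewiseLinear.continuous (hf : IsPiecewiseLinear f) : Continuous f := by
  obtain ⟨l, hl⟩ := hf
  rw [← continuousOn_univ, ← Icc_zero_one_eq_univ]
  exact hl.le_and_continuousOn_and_subset.2.1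

lemma IsBreakpoints.range_subset_trace (h : IsBreakpoints f 0 1 l) :
    Set.range f ⊆ trace (l.map f) := by
  rw [← Set.image_univ, ← Icc_zero_one_eq_univ]
  exact h.le_and_continuousOn_and_subset.2.2

/-- An edge cut off at `t` is a point or an initial part of a linear piece, so a point off the range
of `f` sees it under a continuous angle. -/
lemma IsBreakpoints.segment_min_subset_range (h : IsBreakpoints f a b l)
    {e : unitInterval × unitInterval} (he : e ∈ l.zip l.tail) (t : unitInterval) :
    segment ℝ (f (min e.1 t)) (f (min e.2 t)) ⊆ Set.range f := by
  have h1 := h.isAffineBetween e he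
  rcases le_total t e.1 with ht | ht
  · rw [min_eq_right ht, min_eq_right (ht.trans h1.1.le), segment_same]
    simp
  · rw [min_eq_left ht]
    exact h1.segment_subset_range ⟨le_min h1.1.le ht, min_le_left _ _⟩

end breakpoints

/-! ### The angle swept along an initial piece of a path -/

/-- The total angle by which `x` sees `f` turn on `[0,t]`, computed from breakpoints `l`. -/
noncomputable def sweep (f : unitInterval → Plane) (l : List unitInterval) (x : Plane)
    (t : unitInterval) : ℝ :=
  edgeSum (fun s s' => ang x (f (min s t)) (f (min s' t))) l

section sweep

variable {f : unitInterval → Plane} {l : List unitInterval}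

lemma sweep_zero (f : unitInterval → Plane) (l : List unitInterval) (x : Plane) :
    sweep f l x 0 = 0 := by
  simp [sweep, ang_self, edgeSum]

lemma sweep_one (f : unitInterval → Plane) (l : List unitInterval) (x : Plane) :
    sweep f l x 1 = edgeSum (ang x) (l.map f) := by
  have h (s : unitInterval) : min s 1 = s := min_eq_left s.2.2
  simp only [sweep, h, edgeSum_map]

lemma coe_sweep (h : IsBreakpoints f 0 1 l) {x : Plane} (hx : x ∉ Set.range f)
    (t : unitInterval) : (sweep f l x t : Real.Angle) = dir x (f t) - dir x (f 0) := by
  have hne (s : unitInterval) : x ≠ f s := fun e => hx ⟨s, e.symm⟩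
  have key := edgeSum_sub (fun s => dir x (f (min s t))) h.1 h.2.1
  rw [min_eq_left (show 0 ≤ t from t.2.1), min_eq_right (show t ≤ 1 from t.2.2)] at key
  rw [sweep, edgeSum_coe, ← key]
  exact edgeSum_congr fun e _ => coe_ang (hne _) (hne _)

lemma continuousAt_sweep (hf : Continuous f) (h : IsBreakpoints f 0 1 l) {p : Plane × unitInterval}
    (hx : p.1 ∉ Set.range f) :
    ContinuousAt (fun p : Plane × unitInterval => sweep f l p.1 p.2) p := by
  refine continuousAt_edgeSum (fun (p : Plane × unitInterval) s s' =>
    ang p.1 (f (min s p.2)) (f (min s' p.2))) fun e he => ?_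
  exact ContinuousAt.ang continuousAt_fst (by fun_prop) (by fun_prop)
    fun hm => hx (h.segment_min_subset_range he p.2 hm)

/-- The two sweeps agree at `t = 0`, and their difference is continuous in `t` with values in `2πℤ`.
This matters because membership in `oddRegion` supplies breakpoints depending on the point, while
the separating function uses one fixed choice. -/
lemma sweep_eq_sweep (hf : Continuous f) {k : List unitInterval} (hk : IsBreakpoints f 0 1 k)
    (hl : IsBreakpoints f 0 1 l) {x : Plane} (hx : x ∉ Set.range f) (t : unitInterval) :
    sweep f k x t = sweep f l x t := by
  have hc (m) (hm : IsBreakpoints f 0 1 m) : Continuous (sweep f m x) :=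
    continuous_iff_continuousAt.2 fun t =>
      (continuousAt_sweep (p := (x, t)) hf hm hx).comp
        (f := fun t : unitInterval => (x, t)) (by fun_prop)
  have := eq_of_coe_eq_zero (S := Set.univ) isPreconnected_univ
    (F := fun t => sweep f k x t - sweep f l x t) ((hc k hk).sub (hc l hl)).continuousOn
    (fun t _ => by simp [coe_sweep hk hx, coe_sweep hl hx]) (x := t) (y := 0) trivial trivial
  simp only [sweep_zero, sub_zero] at this
  exact _root_.sub_eq_zero.1 this

end sweep

/-! ### The winding of the boundary of a growing strip -/

/-- The winding around `x` of the closed curve `T_t` of a strip. -/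
noncomputable def stripWinding (f g : unitInterval → Plane) (k l : List unitInterval) (x : Plane)
    (t : unitInterval) : ℝ :=
  sweep f k x t + ang x (f t) (g t) - sweep g l x t + ang x (g 0) (f 0)

section strip

variable {f g : unitInterval → Plane} {k l : List unitInterval} {x : Plane}

lemma stripCurve_head?_eq (hk : IsBreakpoints f 0 1 k) :
    (stripCurve f g k l).head? = some (f 0) := by
  simp [stripCurve, hk.1]

lemma stripCurve_getLast?_eq : (stripCurve f g k l).getLast? = some (f 0) := by
  simp [stripCurve]

lemma edges_stripCurve (hk : IsBreakpoints f 0 1 k) (hl : IsBreakpoints g 0 1 l) :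
    edges (stripCurve f g k l) = edges (k.map f) ++ (f 1, g 1) ::
      (((edges (l.map g)).map Prod.swap).reverse ++ [(g 0, f 0)]) := by
  unfold edges stripCurve
  rw [List.append_assoc, zip_tail_append (a := f 1) (b := g 1), zip_tail_append (a := g 0) (b := f 0),
    zip_tail_reverse]
  · rfl
  · simp [hl.1]
  · rfl
  · simp [hk.2.1]
  · simp [hl.2.1]

lemma notMem_of_notMem_trace_stripCurve (hk : IsBreakpoints f 0 1 k) (hl : IsBreakpoints g 0 1 l)
    (hx : x ∉ trace (stripCurve f g k l)) :
    x ∉ Set.range f ∧ x ∉ Set.range g ∧ x ∉ bridge f g 0 ∧ x ∉ bridge f g 1 := by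
  have hE := edges_stripCurve hk hl
  refine ⟨fun h => hx ?_, fun h => hx ?_, fun h => hx ?_, fun h => hx ?_⟩
  · rcases hk.range_subset_trace h with h | h
    · exact Or.inl (by simp only [stripCurve, Set.mem_ofPred_eq, List.mem_append] at h ⊢; tauto)
    · obtain ⟨e, he, h⟩ := Set.mem_iUnion₂.1 h
      exact segment_subset_trace (by rw [hE]; exact List.mem_append_left _ he) h
  · rcases hl.range_subset_trace h with h | h
    · exact Or.inl (by
        simp only [stripCurve, Set.mem_ofPred_eq, List.mem_append, List.mem_reverse] at h ⊢; tauto)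
    · obtain ⟨e, he, h⟩ := Set.mem_iUnion₂.1 h
      refine segment_subset_trace (e := e.swap) ?_ (by rwa [Prod.fst_swap, Prod.snd_swap, segment_symm])
      rw [hE]
      refine List.mem_append_right _ (List.mem_cons_of_mem _ (List.mem_append_left _ ?_))
      exact List.mem_reverse.2 (List.mem_map_of_mem he)
  · exact segment_subset_trace (e := (g 0, f 0)) (by simp [hE]) (by rwa [segment_symm])
  · exact segment_subset_trace (e := (f 1, g 1)) (by simp [hE]) h

lemma stripWinding_zero (h : x ∉ bridge f g 0) : stripWinding f g k l x 0 = 0 := by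
  simp [stripWinding, sweep_zero, ang_swap h]

lemma stripWinding_one (hk : IsBreakpoints f 0 1 k) (hl : IsBreakpoints g 0 1 l)
    (hx : x ∉ Set.range g) :
    stripWinding f g k l x 1 = winding (stripCurve f g k l) x := by
  have hrev : edgeSum (ang x) (l.map g).reverse = -edgeSum (ang x) (l.map g) := by
    rw [← List.map_reverse, edgeSum_map, edgeSum_map]
    refine edgeSum_reverse _ fun e he => ang_swap fun h => ?_
    have h1 := hl.isAffineBetween e he
    exact hx (h1.segment_subset_range (Set.right_mem_Icc.2 h1.1.le) h)
  rw [winding, stripCurve, List.append_assoc, edgeSum_append (a := f 1) (b := g 1),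
    edgeSum_append (a := g 0) (b := f 0), hrev, edgeSum_singleton, stripWinding, sweep_one,
    sweep_one]
  · ring
  · simp [hl.1]
  · rfl
  · simp [hk.2.1]
  · simp [hl.2.1]

/-- The directions telescope around the closed curve. Being off `f` and `g` is enough, so this holds
on the bridges too, where continuity may fail. -/
lemma coe_stripWinding (hk : IsBreakpoints f 0 1 k) (hl : IsBreakpoints g 0 1 l)
    (hf : x ∉ Set.range f) (hg : x ∉ Set.range g) (t : unitInterval) :
    (stripWinding f g k l x t : Real.Angle) = 0 := by
  have h1 (s : unitInterval) : x ≠ f s := fun e => hf ⟨s, e.symm⟩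
  have h2 (s : unitInterval) : x ≠ g s := fun e => hg ⟨s, e.symm⟩
  simp only [stripWinding, Real.Angle.coe_add, Real.Angle.coe_sub, coe_sweep hk hf, coe_sweep hl hg,
    coe_ang (h1 _) (h2 _), coe_ang (h2 _) (h1 _)]
  abel

lemma continuousAt_stripWinding (hfc : Continuous f) (hgc : Continuous g)
    (hk : IsBreakpoints f 0 1 k) (hl : IsBreakpoints g 0 1 l) {p : Plane × unitInterval}
    (hf : p.1 ∉ Set.range f) (hg : p.1 ∉ Set.range g) (h0 : p.1 ∉ bridge f g 0)
    (ht : p.1 ∉ bridge f g p.2) :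
    ContinuousAt (fun p : Plane × unitInterval => stripWinding f g k l p.1 p.2) p := by
  have h1 : ContinuousAt (fun p : Plane × unitInterval => ang p.1 (f p.2) (g p.2)) p :=
    ContinuousAt.ang continuousAt_fst (by fun_prop) (by fun_prop) ht
  have h2 : ContinuousAt (fun p : Plane × unitInterval => ang p.1 (g 0) (f 0)) p :=
    ContinuousAt.ang continuousAt_fst continuousAt_const continuousAt_const
      (by rwa [segment_symm])
  exact (((continuousAt_sweep hfc hk hf).add h1).sub (continuousAt_sweep hgc hl hg)).add h2

lemma exists_isOddPoint_of_mem_oddRegion (hx : x ∈ oddRegion f g 1) :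
    ∃ k l, IsBreakpoints f 0 1 k ∧ IsBreakpoints g 0 1 l ∧ IsOddPoint (stripCurve f g k l) x := by
  obtain ⟨k, l, hk, hl, U, ⟨z, -, -, hU⟩, hxU⟩ := hx
  exact ⟨k, l, hk, hl, hU x hxU⟩

lemma exists_int_stripWinding_one (hfc : Continuous f) (hgc : Continuous g)
    (hk : IsBreakpoints f 0 1 k) (hl : IsBreakpoints g 0 1 l) (hx : x ∈ oddRegion f g 1) :
    ∃ n : ℤ, Odd n ∧ stripWinding f g k l x 1 = n * (2 * Real.pi) := by
  obtain ⟨k', l', hk', hl', hodd⟩ := exists_isOddPoint_of_mem_oddRegion hx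
  obtain ⟨hf, hg, -, -⟩ := notMem_of_notMem_trace_stripCurve hk' hl' hodd.1
  rw [stripWinding, sweep_eq_sweep hfc hk hk' hf, sweep_eq_sweep hgc hl hl' hg]
  change ∃ n : ℤ, Odd n ∧ stripWinding f g k' l' x 1 = n * (2 * Real.pi)
  rw [stripWinding_one hk' hl' hg]
  exact exists_int_winding_of_isOddPoint (stripCurve_head?_eq hk') stripCurve_getLast?_eq hodd

end strip

lemma cos_half_int_mul_two_pi_ne_zero (n : ℤ) : Real.cos (n * (2 * Real.pi) / 2) ≠ 0 := by
  rw [show (n : ℝ) * (2 * Real.pi) / 2 = n * Real.pi by ring, Real.cos_int_mul_pi]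
  exact zpow_ne_zero _ (by norm_num)

lemma cos_half_int_mul_two_pi_neg {n : ℤ} (hn : Odd n) :
    Real.cos (n * (2 * Real.pi) / 2) < 0 := by
  rw [show (n : ℝ) * (2 * Real.pi) / 2 = n * Real.pi by ring, Real.cos_int_mul_pi, hn.neg_one_zpow]
  norm_num

end PlaneStrip

theorem mainTheorem5 (ε : ℝ) (f g : unitInterval → PlaneStrip.Plane)
    (hfg : PlaneStrip.IsStripWithDisjointEnds ε f g)
    (G : Set PlaneStrip.Plane) (hG : PlaneStrip.IsGraph G)
    (hGS : G ⊆ PlaneStrip.oddRegion f g 1) :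
    PlaneStrip.Separates
      {p : G × unitInterval | (p.1 : PlaneStrip.Plane) ∈ PlaneStrip.bridge f g p.2}
      {p : G × unitInterval | p.2 = 0}
      {p : G × unitInterval | p.2 = 1} := by
  have hfc := hfg.piecewiseLinear_left.continuous
  have hgc := hfg.piecewiseLinear_right.continuous
  obtain ⟨k, hk⟩ := hfg.piecewiseLinear_left
  obtain ⟨l, hl⟩ := hfg.piecewiseLinear_right
  have hoff (x : G) : x.1 ∉ Set.range f ∧ x.1 ∉ Set.range g ∧ x.1 ∉ PlaneStrip.bridge f g 0 ∧
      x.1 ∉ PlaneStrip.bridge f g 1 := by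
    obtain ⟨k', l', hk', hl', h⟩ := PlaneStrip.exists_isOddPoint_of_mem_oddRegion (hGS x.2)
    exact PlaneStrip.notMem_of_notMem_trace_stripCurve hk' hl' h.1
  -- This is `1` or `-1` according to the parity of the winding number of `T_t` around the point.
  let c : G × unitInterval → ℝ := fun p => (PlaneStrip.stripWinding f g k l p.1 p.2 / 2).cos
  set C := {p : G × unitInterval | (p.1 : PlaneStrip.Plane) ∈ PlaneStrip.bridge f g p.2} with hC
  have hc : Continuous fun p : (Cᶜ : Set (G × unitInterval)) => c p.1 := by
    refine continuous_iff_continuousAt.2 fun p => ?_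
    obtain ⟨h1, h2, h3, -⟩ := hoff p.1.1
    have h4 := (PlaneStrip.continuousAt_stripWinding (p := ((p.1.1 : PlaneStrip.Plane), p.1.2))
      hfc hgc hk hl h1 h2 h3 p.2).comp
      (f := fun p : (Cᶜ : Set (G × unitInterval)) => ((p.1.1 : PlaneStrip.Plane), p.1.2))
      (x := p) (by fun_prop)
    exact Real.continuous_cos.continuousAt.comp (h4.div_const 2)
  have hne (p : G × unitInterval) : c p ≠ 0 := by
    obtain ⟨h1, h2, -, -⟩ := hoff p.1
    obtain ⟨n, hn⟩ := PlaneStrip.exists_int_of_coe_eq_zero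
      (PlaneStrip.coe_stripWinding hk hl h1 h2 p.2)
    simp only [c, hn]
    exact PlaneStrip.cos_half_int_mul_two_pi_ne_zero n
  refine ⟨{p | p ∉ C ∧ 0 < c p}, {p | p ∉ C ∧ c p < 0}, ?_, ?_, ?_, ?_, ?_, ?_⟩
  · ext p
    have := (hne p).lt_or_gt
    simp only [Set.mem_union, Set.mem_ofPred_eq, Set.mem_compl_iff]
    tauto
  · exact Set.disjoint_left.2 fun p hp hp' => lt_asymm hp.2 hp'.2
  -- In the subspace `Cᶜ` the condition `p ∉ C` is automatic.
  · convert isOpen_lt continuous_const hc using 1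
    ext p
    exact and_iff_right p.2
  · convert isOpen_lt hc continuous_const using 1
    ext p
    exact and_iff_right p.2
  · rintro ⟨x, t⟩ (rfl : t = 0)
    obtain ⟨-, -, h3, -⟩ := hoff x
    exact ⟨h3, by simp [c, PlaneStrip.stripWinding_zero h3]⟩
  · rintro ⟨x, t⟩ (rfl : t = 1)
    obtain ⟨-, -, -, h4⟩ := hoff x
    obtain ⟨n, hn, h⟩ := PlaneStrip.exists_int_stripWinding_one hfc hgc hk hl (hGS x.2)
    refine ⟨h4, ?_⟩
    simp only [c, h]
    exact PlaneStrip.cos_half_int_mul_two_pi_neg hn
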